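/- Let $(M,g)$ be a compact smooth Riemannian manifold without boundary. There is a constant $A>0$, depending only on $(M,g)$, such that for every $\lambda>0$ and every real-valued eigenfunction $\varphi_\lambda\not\equiv 0$ of the Laplacian of $g$ with eigenvalue $\lambda^2$, that is, $$-\Delta_g\varphi_\lambda=\lambda^2\varphi_\lambda,\qquad \Delta_g=\frac{1}{\sqrt{g}}\sum_{i,j}\frac{\partial}{\partial x_i}\Big(g^{ij}\sqrt{g}\,\frac{\partial}{\partial x_j}\Big)\ \text{ in local coordinates},$$ every geodesic ball $B(x,r)=\{y\in M: d_g(x,y)<r\}$ with $x\in M$ and $r>A/\lambda$ contains a zero of $\varphi_\lambda$. -/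

import Mathlib

open Bundle Manifold
open scoped ContDiff

noncomputable section

/-- The partial derivative `∂F/∂uᵢ` at `u` of a function `F` on `ℝᵐ`. -/
def coordDeriv {m : ℕ} (i : Fin m) (F : EuclideanSpace ℝ (Fin m) → ℝ)
    (u : EuclideanSpace ℝ (Fin m)) : ℝ :=
  fderiv ℝ F u (EuclideanSpace.single i 1)

section RiemannianLaplacian

variable {m : ℕ} {M : Type*} [TopologicalSpace M] [ChartedSpace (EuclideanSpace ℝ (Fin m)) M]

/-- The coordinate vector field `∂ᵢ` of a chart `e`, at the point with coordinates `u`. -/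
def coordVector (e : OpenPartialHomeomorph M (EuclideanSpace ℝ (Fin m))) (i : Fin m)
    (u : EuclideanSpace ℝ (Fin m)) : TangentSpace (𝓡 m) (e.symm u) :=
  mfderiv (𝓡 m) (𝓡 m) e.symm u (EuclideanSpace.single i (1 : ℝ))

variable [RiemannianBundle (fun x : M ↦ TangentSpace (𝓡 m) x)]

/-- The matrix `(gᵢⱼ)` of the Riemannian metric in the chart `e`: `gᵢⱼ = ⟨∂ᵢ, ∂ⱼ⟩`. -/
def metricMatrix (e : OpenPartialHomeomorph M (EuclideanSpace ℝ (Fin m)))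
    (u : EuclideanSpace ℝ (Fin m)) : Matrix (Fin m) (Fin m) ℝ :=
  Matrix.of fun i j ↦ inner ℝ (coordVector e i u) (coordVector e j u)

/-- The Laplacian of `f`, computed in the chart `e` at the point with coordinates `u`:
`(1/√g) ∑ᵢⱼ ∂ᵢ (gⁱʲ √g ∂ⱼ f)`, where `√g = √(det (gᵢⱼ))` and `(gⁱʲ)` is the inverse of `(gᵢⱼ)`.
It is meaningful for `u` in the target of `e`. -/
def laplacianInChart (e : OpenPartialHomeomorph M (EuclideanSpace ℝ (Fin m))) (f : M → ℝ)
    (u : EuclideanSpace ℝ (Fin m)) : ℝ :=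
  1 / √(metricMatrix e u).det *
    ∑ i, ∑ j, coordDeriv i
      (fun w ↦ (metricMatrix e w)⁻¹ i j * √(metricMatrix e w).det *
        coordDeriv j (fun z ↦ f (e.symm z)) w) u

/-- `φ` is a (real) eigenfunction of frequency `lam`: it is not identically zero, it is of class
`C²`, and it satisfies `-Δ φ = lam² φ` in all local coordinates of the atlas. -/
structure IsLaplaceEigenfunction (lam : ℝ) (φ : M → ℝ) : Prop where
  ne_zero : φ ≠ 0
  contMDiff : ContMDiff (𝓡 m) 𝓘(ℝ, ℝ) 2 φ
  eigen : ∀ e ∈ atlas (EuclideanSpace ℝ (Fin m)) M, ∀ x ∈ e.source,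
    -laplacianInChart e φ (e x) = lam ^ 2 * φ x

end RiemannianLaplacian

end

/-!
The proof is a comparison argument based on the maximum principle alone; no integration by parts is
needed.

Suppose that `-Δφ = λ² φ` and that `φ` does not vanish on a ball `B`. If `ψ` is a `C²` function on a
neighbourhood of a point `p` of `B` and `ψ / |φ|` has a local maximum at `p`, then `ψ - c φ` with
`c = ψ p / φ p` has a local maximum there, so `Δψ ≤ c Δφ = -λ² ψ` at `p`
(`coordLaplacian_le_of_isLocalMax_div_abs`). Two choices of `ψ` give the theorem.

* In a chart, with Euclidean coordinate norm, let `ψ w = (ρ² - |w - u₀|²)²` on a coordinate ball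
  inside `B`. It satisfies `Δψ ≥ -(κ / ρ²) ψ` there, with `κ` depending only on the ellipticity and
  on the size of the coefficients of `Δ` (`neg_mul_barrier_le_coordLaplacian`). As `ψ` vanishes on
  the boundary of the coordinate ball, `ψ / |φ|` has an interior maximum, and `λ² ρ² ≤ κ`
  (`exists_forall_eigenvalue_mul_sq_le`). Inverse charts are locally Lipschitz
  (`exists_riemannianEDist_symm_le`), so that by compactness a ball of radius greater than `L ρ`
  contains such a coordinate ball, for all `ρ ≤ ε`, with uniform `L`, `ε`, `κ`
  (`exists_hasZeroFreeBallBound_univ`).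
* The function `ψ = 1` shows that `|φ|` has no positive local minimum
  (`IsLaplaceEigenfunction.eq_zero_of_isLocalMin_abs`). Hence `φ` vanishes somewhere on each set
  `{y | edist x y < ⊤}`, which is open and compact. This covers the balls of radius greater than
  the largest finite distance, which occur when `λ` is small.
-/

open Filter Topology Metric
open scoped NNReal ENNReal

/-! ### The maximum principle for the Laplacian in coordinates -/

section EuclideanOperator

variable {m : ℕ} {u : EuclideanSpace ℝ (Fin m)}

theorem fderiv_fderiv_self_nonpos_of_isLocalMax {E : Type*} [NormedAddCommGroup E]
    [NormedSpace ℝ E] {G : E → ℝ} {u : E} (hG : ContDiffAt ℝ 2 G u) (hmax : IsLocalMax G u)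
    (v : E) : fderiv ℝ (fderiv ℝ G) u v v ≤ 0 := by
  set f : ℝ → ℝ := fun t ↦ G (u + t • v) with hf
  have hline : ∀ t : ℝ, HasDerivAt (fun t : ℝ ↦ u + t • v) v t := fun t ↦ by
    simpa using ((hasDerivAt_id t).smul_const v).const_add u
  have hcont : ContinuousAt (fun t : ℝ ↦ u + t • v) 0 := (hline 0).continuousAt
  have h0 : u + (0 : ℝ) • v = u := by simp
  have hdiff : ∀ᶠ w in 𝓝 u, DifferentiableAt ℝ G w :=
    (hG.eventually (by simp)).mono fun w hw ↦ hw.differentiableAt (by simp)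
  have hdf : deriv f =ᶠ[𝓝 0] fun t ↦ fderiv ℝ G (u + t • v) v := by
    have := hcont.tendsto.eventually (by rw [h0]; exact hdiff)
    filter_upwards [this] with t ht
    exact (ht.hasFDerivAt.comp_hasDerivAt t (hline t)).deriv
  have hD : DifferentiableAt ℝ (fderiv ℝ G) u :=
    (hG.fderiv_right (m := 1) (by norm_num)).differentiableAt (by simp)
  have hddf : deriv (deriv f) 0 = fderiv ℝ (fderiv ℝ G) u v v := by
    rw [hdf.deriv_eq]
    have h1 : HasDerivAt (fun t : ℝ ↦ fderiv ℝ G (u + t • v)) (fderiv ℝ (fderiv ℝ G) u v) 0 :=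
      HasFDerivAt.comp_hasDerivAt (0 : ℝ) (by rw [h0]; exact hD.hasFDerivAt) (hline 0)
    have h2 := h1.clm_apply (hasDerivAt_const (0 : ℝ) v)
    simpa using h2.deriv
  have hmax0 : IsLocalMax f 0 := by
    have := hcont.tendsto.eventually (by rw [h0]; exact hmax)
    filter_upwards [this] with t ht
    simpa [hf] using ht
  have hfc : ContinuousAt f 0 :=
    ContinuousAt.comp (by rw [h0]; exact hG.continuousAt) hcont
  by_contra! hpos
  rw [← hddf] at hpos
  -- A strictly positive second derivative makes `0` a local minimum too, so `f` is locally
  -- constant and its second derivative vanishes.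
  have hmin := isLocalMin_of_deriv_deriv_pos hpos hmax0.deriv_eq_zero hfc
  have hconst : f =ᶠ[𝓝 0] fun _ ↦ f 0 := by
    filter_upwards [hmax0, hmin] with t h1 h2 using le_antisymm h1 h2
  have : deriv (deriv f) 0 = 0 := by
    rw [hconst.deriv.deriv_eq]; simp
  linarith

theorem coordDeriv_coordDeriv {G : EuclideanSpace ℝ (Fin m) → ℝ} (hG : ContDiffAt ℝ 2 G u)
    (i j : Fin m) : coordDeriv i (coordDeriv j G) u =
      fderiv ℝ (fderiv ℝ G) u (EuclideanSpace.single i 1) (EuclideanSpace.single j 1) := by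
  have hD : DifferentiableAt ℝ (fderiv ℝ G) u :=
    (hG.fderiv_right (m := 1) (by norm_num)).differentiableAt (by simp)
  have := (hD.hasFDerivAt.clm_apply (hasFDerivAt_const (EuclideanSpace.single j (1 : ℝ)) u)).fderiv
  unfold coordDeriv
  rw [this]
  simp

theorem differentiableAt_coordDeriv {G : EuclideanSpace ℝ (Fin m) → ℝ} (hG : ContDiffAt ℝ 2 G u)
    (j : Fin m) : DifferentiableAt ℝ (coordDeriv j G) u :=
  ((hG.fderiv_right (m := 1) (by norm_num)).differentiableAt (by simp)).clm_apply
    (differentiableAt_const _)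

theorem coordDeriv_mul {F G : EuclideanSpace ℝ (Fin m) → ℝ} (hF : DifferentiableAt ℝ F u)
    (hG : DifferentiableAt ℝ G u) (i : Fin m) :
    coordDeriv i (fun w ↦ F w * G w) u = F u * coordDeriv i G u + coordDeriv i F u * G u := by
  simp [coordDeriv, fderiv_fun_mul hF hG, mul_comm]

theorem coordDeriv_sub_const_mul {F G : EuclideanSpace ℝ (Fin m) → ℝ} (hF : DifferentiableAt ℝ F u)
    (hG : DifferentiableAt ℝ G u) (c : ℝ) (i : Fin m) :
    coordDeriv i (fun w ↦ F w - c * G w) u = coordDeriv i F u - c * coordDeriv i G u := by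
  simp [coordDeriv, fderiv_fun_sub hF (hG.const_mul c), fderiv_const_mul hG]

theorem coordDeriv_congr {F G : EuclideanSpace ℝ (Fin m) → ℝ} (h : F =ᶠ[𝓝 u] G) (i : Fin m) :
    coordDeriv i F u = coordDeriv i G u := by
  simp [coordDeriv, h.fderiv_eq]

/-- A positive semidefinite second-order operator is nonpositive at a local maximum. -/
theorem sum_mul_coordDeriv_coordDeriv_nonpos {A : Matrix (Fin m) (Fin m) ℝ} (hA : A.PosSemidef)
    {G : EuclideanSpace ℝ (Fin m) → ℝ} (hG : ContDiffAt ℝ 2 G u) (hmax : IsLocalMax G u) :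
    ∑ i, ∑ j, A i j * coordDeriv i (coordDeriv j G) u ≤ 0 := by
  obtain ⟨r, B, rfl⟩ := Matrix.posSemidef_iff_eq_sum_vecMulVec.1 hA
  set H := fderiv ℝ (fderiv ℝ G) u
  -- Writing `A` as a sum of squares turns the sum into one of pure second derivatives.
  calc ∑ i, ∑ j, (∑ k, Matrix.vecMulVec (B k) (star (B k))) i j * coordDeriv i (coordDeriv j G) u
      = ∑ k, H (∑ i, B k i • EuclideanSpace.single i 1)
          (∑ j, B k j • EuclideanSpace.single j 1) := by
        simp only [coordDeriv_coordDeriv hG, Matrix.sum_apply, Matrix.vecMulVec_apply, map_sum,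
          sum_apply, map_smul, smul_apply, smul_eq_mul,
          Finset.sum_mul, star_trivial, Finset.mul_sum]
        calc _ = ∑ i, ∑ k, ∑ j, B k i * B k j * H (EuclideanSpace.single i 1)
                  (EuclideanSpace.single j 1) :=
              Finset.sum_congr rfl fun i _ ↦ Finset.sum_comm
          _ = ∑ k, ∑ i, ∑ j, B k i * B k j * H (EuclideanSpace.single i 1)
                  (EuclideanSpace.single j 1) := Finset.sum_comm
          _ = _ := by
              refine Finset.sum_congr rfl fun k _ ↦ ?_
              rw [Finset.sum_comm]
              refine Finset.sum_congr rfl fun i _ ↦ Finset.sum_congr rfl fun j _ ↦ by ring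
    _ ≤ 0 := Finset.sum_nonpos fun k _ ↦ fderiv_fderiv_self_nonpos_of_isLocalMax hG hmax _

/-- The Laplace–Beltrami operator `(1/√g) ∑ᵢⱼ ∂ᵢ (gⁱʲ √g ∂ⱼ F)` of a matrix-valued function
`g` on `ℝᵐ`, applied to a function on `ℝᵐ`. -/
noncomputable def coordLaplacian (g : EuclideanSpace ℝ (Fin m) → Matrix (Fin m) (Fin m) ℝ)
    (F : EuclideanSpace ℝ (Fin m) → ℝ) (u : EuclideanSpace ℝ (Fin m)) : ℝ :=
  1 / √(g u).det *
    ∑ i, ∑ j, coordDeriv i (fun w ↦ (g w)⁻¹ i j * √(g w).det * coordDeriv j F w) u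

/-- The terms `(1/√g) ∂ᵢ (gⁱʲ √g)` whose sum over `i` is the coefficient of `∂ⱼ` in the
Laplace–Beltrami operator of `g`. -/
noncomputable def driftCoeff (g : EuclideanSpace ℝ (Fin m) → Matrix (Fin m) (Fin m) ℝ)
    (i j : Fin m) (u : EuclideanSpace ℝ (Fin m)) : ℝ :=
  1 / √(g u).det * coordDeriv i (fun w ↦ (g w)⁻¹ i j * √(g w).det) u

variable {g : EuclideanSpace ℝ (Fin m) → Matrix (Fin m) (Fin m) ℝ}

theorem contDiffAt_matrix_det {n : WithTop ℕ∞} {ι : Type*} [Fintype ι] [DecidableEq ι]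
    {g : EuclideanSpace ℝ (Fin m) → Matrix ι ι ℝ}
    (hg : ∀ i j, ContDiffAt ℝ n (fun w ↦ g w i j) u) : ContDiffAt ℝ n (fun w ↦ (g w).det) u := by
  simp only [Matrix.det_apply']
  exact ContDiffAt.sum fun σ _ ↦ contDiffAt_const.mul (contDiffAt_prod fun i _ ↦ hg _ _)

theorem contDiffAt_matrix_inv {n : WithTop ℕ∞} (hg : ∀ i j, ContDiffAt ℝ n (fun w ↦ g w i j) u)
    (hu : (g u).det ≠ 0) (i j : Fin m) : ContDiffAt ℝ n (fun w ↦ (g w)⁻¹ i j) u := by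
  simp only [Matrix.inv_def, Matrix.smul_apply, Ring.inverse_eq_inv', smul_eq_mul,
    Matrix.adjugate_apply]
  refine ((contDiffAt_matrix_det hg).inv hu).mul (contDiffAt_matrix_det fun k l ↦ ?_)
  simp only [Matrix.updateRow_apply]
  split_ifs
  · exact contDiffAt_const
  · exact hg k l

theorem contDiffAt_inv_mul_sqrt_det {n : WithTop ℕ∞}
    (hg : ∀ i j, ContDiffAt ℝ n (fun w ↦ g w i j) u)
    (hu : (g u).PosDef) (i j : Fin m) :
    ContDiffAt ℝ n (fun w ↦ (g w)⁻¹ i j * √(g w).det) u :=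
  (contDiffAt_matrix_inv hg hu.det_pos.ne' i j).mul
    ((contDiffAt_matrix_det hg).sqrt hu.det_pos.ne')

/-- The nondivergence form of the Laplace–Beltrami operator. -/
theorem coordLaplacian_eq (hg : ∀ i j, ContDiffAt ℝ 1 (fun w ↦ g w i j) u) (hu : (g u).PosDef)
    {F : EuclideanSpace ℝ (Fin m) → ℝ} (hF : ContDiffAt ℝ 2 F u) :
    coordLaplacian g F u = ∑ i, ∑ j, (g u)⁻¹ i j * coordDeriv i (coordDeriv j F) u +
      ∑ i, ∑ j, driftCoeff g i j u * coordDeriv j F u := by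
  have hs : √(g u).det ≠ 0 := (Real.sqrt_pos.2 hu.det_pos).ne'
  simp only [coordLaplacian, Finset.mul_sum, ← Finset.sum_add_distrib]
  refine Finset.sum_congr rfl fun i _ ↦ Finset.sum_congr rfl fun j _ ↦ ?_
  rw [coordDeriv_mul ((contDiffAt_inv_mul_sqrt_det hg hu i j).differentiableAt (by simp))
    (differentiableAt_coordDeriv hF j), driftCoeff]
  field_simp

theorem coordLaplacian_nonpos_of_isLocalMax (hg : ∀ i j, ContDiffAt ℝ 1 (fun w ↦ g w i j) u)
    (hu : (g u).PosDef) {G : EuclideanSpace ℝ (Fin m) → ℝ} (hG : ContDiffAt ℝ 2 G u)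
    (hmax : IsLocalMax G u) : coordLaplacian g G u ≤ 0 := by
  rw [coordLaplacian_eq hg hu hG]
  have : ∀ j, coordDeriv j G u = 0 := fun j ↦ by simp [coordDeriv, hmax.fderiv_eq_zero]
  simpa [this] using sum_mul_coordDeriv_coordDeriv_nonpos hu.inv.posSemidef hG hmax

theorem coordLaplacian_sub_const_mul (hg : ∀ i j, ContDiffAt ℝ 1 (fun w ↦ g w i j) u)
    (hu : (g u).PosDef) {F G : EuclideanSpace ℝ (Fin m) → ℝ} (hF : ContDiffAt ℝ 2 F u)
    (hG : ContDiffAt ℝ 2 G u) (c : ℝ) :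
    coordLaplacian g (fun w ↦ F w - c * G w) u = coordLaplacian g F u - c * coordLaplacian g G u := by
  rw [coordLaplacian_eq hg hu hF, coordLaplacian_eq hg hu hG,
    coordLaplacian_eq hg hu (hF.sub (contDiffAt_const.mul hG))]
  have hd {F : EuclideanSpace ℝ (Fin m) → ℝ} (hF : ContDiffAt ℝ 2 F u) :
      ∀ᶠ w in 𝓝 u, DifferentiableAt ℝ F w :=
    (hF.eventually (by simp)).mono fun w hw ↦ hw.differentiableAt (by simp)
  have h1 (j : Fin m) : coordDeriv j (fun w ↦ F w - c * G w) =ᶠ[𝓝 u]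
      fun w ↦ coordDeriv j F w - c * coordDeriv j G w := by
    filter_upwards [hd hF, hd hG] with w h1 h2 using coordDeriv_sub_const_mul h1 h2 c j
  have h2 (i j : Fin m) : coordDeriv i (coordDeriv j (fun w ↦ F w - c * G w)) u =
      coordDeriv i (coordDeriv j F) u - c * coordDeriv i (coordDeriv j G) u := by
    rw [coordDeriv_congr (h1 j), coordDeriv_sub_const_mul (differentiableAt_coordDeriv hF j)
      (differentiableAt_coordDeriv hG j)]
  simp only [h2, (h1 _).eq_of_nhds, mul_sub, Finset.sum_sub_distrib, mul_add, Finset.mul_sum]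
  simp only [mul_left_comm c]
  ring

/-- If `-ΔF = μ F` at `u` and `ψ` touches a multiple of `|F|` from below at `u`, then `Δψ ≤ -μ ψ`
at `u`. This is the only way in which the eigenvalue equation is used. -/
theorem coordLaplacian_le_of_isLocalMax_div_abs
    (hg : ∀ i j, ContDiffAt ℝ 1 (fun w ↦ g w i j) u) (hu : (g u).PosDef)
    {F ψ : EuclideanSpace ℝ (Fin m) → ℝ} (hF : ContDiffAt ℝ 2 F u) (hψ : ContDiffAt ℝ 2 ψ u)
    (hFu : F u ≠ 0) {μ : ℝ} (hmax : IsLocalMax (fun w ↦ ψ w / |F w|) u)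
    (heig : -coordLaplacian g F u = μ * F u) : coordLaplacian g ψ u ≤ -(μ * ψ u) := by
  -- `F` keeps its sign near `u`, so the multiple of `|F|` touched by `ψ` is locally a multiple of `F`.
  have hsign : ∀ᶠ w in 𝓝 u, 0 < F w / F u := by
    have : ContinuousAt (fun w ↦ F w / F u) u := hF.continuousAt.div_const _
    exact this.eventually (lt_mem_nhds (by simp [hFu]))
  have hG : IsLocalMax (fun w ↦ ψ w - ψ u / F u * F w) u := by
    filter_upwards [hmax, hsign] with w hw hs
    have hFw : F w ≠ 0 := by rintro h; simp [h] at hs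
    have key : ψ u / F u * F w = ψ u / |F u| * |F w| := by
      have h1 : |F w| / |F u| = F w / F u := by rw [← abs_div, abs_of_pos hs]
      rw [div_mul_eq_mul_div, div_mul_eq_mul_div, mul_div_assoc, mul_div_assoc, h1]
    rw [div_le_iff₀ (abs_pos.2 hFw)] at hw
    rw [key, div_mul_cancel₀ _ hFu]
    linarith
  have h := coordLaplacian_nonpos_of_isLocalMax hg hu (hψ.sub (contDiffAt_const.mul hF)) hG
  rw [coordLaplacian_sub_const_mul hg hu hψ hF] at h
  have h2 : coordLaplacian g F u = -(μ * F u) := by linarith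
  rw [h2] at h
  have h3 : ψ u / F u * -(μ * F u) = -(μ * ψ u) := by field_simp
  linarith

end EuclideanOperator

/-! ### A subsolution on small Euclidean balls -/

section Barrier

variable {m : ℕ} {u : EuclideanSpace ℝ (Fin m)}

theorem coordDeriv_barrier (u₀ : EuclideanSpace ℝ (Fin m)) (ρ : ℝ) (j : Fin m)
    (u : EuclideanSpace ℝ (Fin m)) :
    coordDeriv j (fun w ↦ (ρ ^ 2 - ‖w - u₀‖ ^ 2) ^ 2) u =
      -4 * (ρ ^ 2 - ‖u - u₀‖ ^ 2) * (u j - u₀ j) := by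
  have h1 : HasFDerivAt (fun w ↦ ‖w - u₀‖ ^ 2) (2 • innerSL ℝ (u - u₀)) u := by
    simpa using ((hasFDerivAt_id u).sub_const u₀).norm_sq
  have h2 := (h1.const_sub (ρ ^ 2)).pow 2
  rw [coordDeriv, h2.fderiv]
  simp [EuclideanSpace.inner_single_right]
  ring

theorem coordDeriv_coordDeriv_barrier (u₀ : EuclideanSpace ℝ (Fin m)) (ρ : ℝ) (i j : Fin m)
    (u : EuclideanSpace ℝ (Fin m)) :
    coordDeriv i (coordDeriv j (fun w ↦ (ρ ^ 2 - ‖w - u₀‖ ^ 2) ^ 2)) u =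
      8 * ((u i - u₀ i) * (u j - u₀ j)) -
        4 * (ρ ^ 2 - ‖u - u₀‖ ^ 2) * (1 : Matrix (Fin m) (Fin m) ℝ) i j := by
  have h1 : HasFDerivAt (fun w ↦ ‖w - u₀‖ ^ 2) (2 • innerSL ℝ (u - u₀)) u := by
    simpa using ((hasFDerivAt_id u).sub_const u₀).norm_sq
  have h2 : HasFDerivAt (fun w : EuclideanSpace ℝ (Fin m) ↦ w j - u₀ j)
      (EuclideanSpace.proj (𝕜 := ℝ) j) u :=
    ((EuclideanSpace.proj (𝕜 := ℝ) j).hasFDerivAt (x := u)).sub_const (u₀ j)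
  have h3 := ((h1.const_sub (ρ ^ 2)).const_mul (-4)).mul h2
  rw [show coordDeriv j (fun w ↦ (ρ ^ 2 - ‖w - u₀‖ ^ 2) ^ 2) = fun w ↦
    -4 * (ρ ^ 2 - ‖w - u₀‖ ^ 2) * (w j - u₀ j) from funext (coordDeriv_barrier u₀ ρ j)]
  rw [coordDeriv]
  erw [h3.fderiv]
  simp [EuclideanSpace.inner_single_right, Matrix.one_apply, eq_comm]
  ring

variable {g : EuclideanSpace ℝ (Fin m) → Matrix (Fin m) (Fin m) ℝ}

/-- The function `(ρ² - |w - u₀|²)²` is a subsolution of `Δψ + (κ / ρ²) ψ = 0` on the ball of radius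
`ρ`, with `κ` depending only on the ellipticity constant `c` and on the bound `C` of the
coefficients: near the boundary of the ball the term `8 gⁱʲ vᵢ vⱼ` dominates. -/
theorem neg_mul_barrier_le_coordLaplacian (hg : ∀ i j, ContDiffAt ℝ 1 (fun w ↦ g w i j) u)
    (hu : (g u).PosDef) {c C : ℝ} (hc : 0 < c)
    (hell : ∀ v : EuclideanSpace ℝ (Fin m),
      c * ‖v‖ ^ 2 ≤ ∑ i, ∑ j, (g u)⁻¹ i j * (v i * v j))
    (htr : (g u)⁻¹.trace ≤ C)
    (hdrift : ∀ v : EuclideanSpace ℝ (Fin m), ‖v‖ ≤ 1 →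
      ∑ i, ∑ j, driftCoeff g i j u * v j ≤ C)
    {u₀ : EuclideanSpace ℝ (Fin m)} {ρ : ℝ} (hρ : ρ ≤ 1) (huρ : ‖u - u₀‖ < ρ) :
    -(2 * (c + C) ^ 2 / c * (ρ ^ 2 - ‖u - u₀‖ ^ 2) ^ 2) ≤
      ρ ^ 2 * coordLaplacian g (fun w ↦ (ρ ^ 2 - ‖w - u₀‖ ^ 2) ^ 2) u := by
  have hψ : ContDiffAt ℝ 2 (fun w ↦ (ρ ^ 2 - ‖w - u₀‖ ^ 2) ^ 2) u :=
    (contDiffAt_const.sub ((contDiffAt_id.sub contDiffAt_const).norm_sq ℝ)).pow 2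
  set s := ρ ^ 2 - ‖u - u₀‖ ^ 2 with hs
  have hspos : 0 < s := by
    have := norm_nonneg (u - u₀)
    nlinarith
  have e1 : ∑ i, ∑ j, (g u)⁻¹ i j *
      coordDeriv i (coordDeriv j (fun w ↦ (ρ ^ 2 - ‖w - u₀‖ ^ 2) ^ 2)) u =
      8 * ∑ i, ∑ j, (g u)⁻¹ i j * ((u - u₀) i * (u - u₀) j) - 4 * s * (g u)⁻¹.trace := by
    have (i j : Fin m) : (g u)⁻¹ i j *
        coordDeriv i (coordDeriv j (fun w ↦ (ρ ^ 2 - ‖w - u₀‖ ^ 2) ^ 2)) u =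
        8 * ((g u)⁻¹ i j * ((u - u₀) i * (u - u₀) j)) -
          4 * s * ((g u)⁻¹ i j * (1 : Matrix (Fin m) (Fin m) ℝ) i j) := by
      rw [coordDeriv_coordDeriv_barrier, ← hs, PiLp.sub_apply, PiLp.sub_apply]
      ring
    simp only [this, Finset.sum_sub_distrib, ← Finset.mul_sum, Matrix.trace, Matrix.diag_apply]
    simp [Matrix.one_apply]
  have e2 : ∑ i, ∑ j, driftCoeff g i j u *
      coordDeriv j (fun w ↦ (ρ ^ 2 - ‖w - u₀‖ ^ 2) ^ 2) u =
      -(4 * s * ∑ i, ∑ j, driftCoeff g i j u * (u - u₀) j) := by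
    simp only [coordDeriv_barrier, Finset.mul_sum, ← Finset.sum_neg_distrib, PiLp.sub_apply, ← hs]
    exact Finset.sum_congr rfl fun i _ ↦ Finset.sum_congr rfl fun j _ ↦ by ring
  rw [coordLaplacian_eq hg hu hψ, e1, e2]
  have b1 := hell (u - u₀)
  have b2 := hdrift (u - u₀) (huρ.le.trans hρ)
  rw [show ‖u - u₀‖ ^ 2 = ρ ^ 2 - s by rw [hs]; ring] at b1
  have b3 : 8 * (c * (ρ ^ 2 - s)) - 8 * s * C ≤
      8 * ∑ i, ∑ j, (g u)⁻¹ i j * ((u - u₀) i * (u - u₀) j) - 4 * s * (g u)⁻¹.trace +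
      -(4 * s * ∑ i, ∑ j, driftCoeff g i j u * (u - u₀) j) := by nlinarith
  refine le_trans ?_ (mul_le_mul_of_nonneg_left b3 (sq_nonneg ρ))
  -- The difference of the two sides is a perfect square: this is the choice of the constant.
  have key : ρ ^ 2 * (8 * (c * (ρ ^ 2 - s)) - 8 * s * C) + 2 * (c + C) ^ 2 / c * s ^ 2 =
      2 / c * ((c + C) * s - 2 * c * ρ ^ 2) ^ 2 := by
    field_simp
    ring
  have : 0 ≤ 2 / c * ((c + C) * s - 2 * c * ρ ^ 2) ^ 2 := by positivity
  linarith

theorem continuousAt_driftCoeff (hg : ∀ i j, ContDiffAt ℝ 1 (fun w ↦ g w i j) u)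
    (hu : (g u).PosDef) (i j : Fin m) : ContinuousAt (driftCoeff g i j) u := by
  have h1 : ContinuousAt (fun w ↦ √(g w).det) u :=
    ((contDiffAt_matrix_det hg).sqrt hu.det_pos.ne').continuousAt
  have h2 := (contDiffAt_inv_mul_sqrt_det hg hu i j).fderiv_right (m := 0) (by norm_num)
  exact (continuousAt_const.div h1 (Real.sqrt_pos.2 hu.det_pos).ne').mul
    (h2.continuousAt.clm_apply continuousAt_const)

/-- A continuous family of positive definite matrices on a compact set is uniformly elliptic. -/
theorem exists_uniform_ellipticity {X : Type*} [TopologicalSpace X] {K : Set X} (hK : IsCompact K)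
    {a : X → Matrix (Fin m) (Fin m) ℝ} (ha : ContinuousOn a K) (hpos : ∀ u ∈ K, (a u).PosDef) :
    ∃ c : ℝ, 0 < c ∧ ∀ u ∈ K, ∀ v : EuclideanSpace ℝ (Fin m),
      c * ‖v‖ ^ 2 ≤ ∑ i, ∑ j, a u i j * (v i * v j) := by
  have hcont : ContinuousOn (fun p : X × EuclideanSpace ℝ (Fin m) ↦
      ∑ i, ∑ j, a p.1 i j * (p.2 i * p.2 j)) (K ×ˢ sphere 0 1) := by
    have h1 : ContinuousOn (fun p : X × EuclideanSpace ℝ (Fin m) ↦ a p.1) (K ×ˢ sphere 0 1) :=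
      ha.comp continuousOn_fst fun p hp ↦ hp.1
    refine continuousOn_finsetSum _ fun i _ ↦ continuousOn_finsetSum _ fun j _ ↦ ?_
    have h2 : ContinuousOn (fun p : X × EuclideanSpace ℝ (Fin m) ↦ a p.1 i j)
        (K ×ˢ sphere 0 1) := continuousOn_pi.1 (continuousOn_pi.1 h1 i) j
    exact h2.mul (by fun_prop)
  obtain ⟨c, hc, hcb⟩ := (hK.prod (isCompact_sphere (0 : EuclideanSpace ℝ (Fin m))
    1)).exists_forall_le' (a := 0) hcont (by
      rintro ⟨u, v⟩ ⟨hu, hv⟩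
      have hv0 : v.ofLp ≠ 0 := by
        intro h
        have : v = 0 := by ext i; simp [h]
        simp [this] at hv
      have := (hpos u hu).dotProduct_mulVec_pos hv0
      simpa [dotProduct, Matrix.mulVec, Finset.mul_sum, mul_left_comm] using this)
  refine ⟨c, hc, fun u hu v ↦ ?_⟩
  rcases eq_or_ne v 0 with rfl | hv
  · simp
  have hv' : ‖v‖ ≠ 0 := norm_ne_zero_iff.2 hv
  have h := hcb (u, ‖v‖⁻¹ • v) ⟨hu, by simp [norm_smul, hv']⟩
  have e : ∑ i, ∑ j, a u i j * ((‖v‖⁻¹ • v) i * (‖v‖⁻¹ • v) j) =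
      (‖v‖ ^ 2)⁻¹ * ∑ i, ∑ j, a u i j * (v i * v j) := by
    simp only [Finset.mul_sum, PiLp.smul_apply, smul_eq_mul]
    exact Finset.sum_congr rfl fun i _ ↦ Finset.sum_congr rfl fun j _ ↦ by ring
  rwa [e, inv_mul_eq_div, le_div_iff₀ (by positivity)] at h

theorem exists_ellipticity_bounds {U K : Set (EuclideanSpace ℝ (Fin m))} (hK : IsCompact K)
    (hKU : K ⊆ U) (hg : ∀ u ∈ U, ∀ i j, ContDiffAt ℝ 1 (fun w ↦ g w i j) u)
    (hpos : ∀ u ∈ U, (g u).PosDef) :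
    ∃ c C : ℝ, 0 < c ∧ 0 < C ∧ ∀ u ∈ K,
      (∀ v : EuclideanSpace ℝ (Fin m), c * ‖v‖ ^ 2 ≤ ∑ i, ∑ j, (g u)⁻¹ i j * (v i * v j)) ∧
      (g u)⁻¹.trace ≤ C ∧
      ∀ v : EuclideanSpace ℝ (Fin m), ‖v‖ ≤ 1 → ∑ i, ∑ j, driftCoeff g i j u * v j ≤ C := by
  have hinv : ContinuousOn (fun u ↦ (g u)⁻¹) K :=
    continuousOn_pi.2 fun i ↦ continuousOn_pi.2 fun j u hu ↦
      (contDiffAt_matrix_inv (hg u (hKU hu)) (hpos u (hKU hu)).det_pos.ne'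
        i j).continuousAt.continuousWithinAt
  obtain ⟨c, hc, hcb⟩ := exists_uniform_ellipticity hK hinv fun u hu ↦ (hpos u (hKU hu)).inv
  have htr : ContinuousOn (fun u ↦ (g u)⁻¹.trace) K :=
    (continuous_id.matrix_trace (R := ℝ) (n := Fin m)).comp_continuousOn hinv
  obtain ⟨C₁, hC₁⟩ := hK.bddAbove_image htr
  have hdrift : ContinuousOn (fun p : EuclideanSpace ℝ (Fin m) × EuclideanSpace ℝ (Fin m) ↦
      ∑ i, ∑ j, driftCoeff g i j p.1 * p.2 j) (K ×ˢ closedBall 0 1) := by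
    refine continuousOn_finsetSum _ fun i _ ↦ continuousOn_finsetSum _ fun j _ ↦ ?_
    have h1 : ContinuousOn (driftCoeff g i j) K := fun u hu ↦
      (continuousAt_driftCoeff (hg u (hKU hu)) (hpos u (hKU hu)) i j).continuousWithinAt
    have h2 : ContinuousOn
        (fun p : EuclideanSpace ℝ (Fin m) × EuclideanSpace ℝ (Fin m) ↦ driftCoeff g i j p.1)
        (K ×ˢ closedBall 0 1) := h1.comp continuousOn_fst fun p hp ↦ hp.1
    exact h2.mul (by fun_prop)
  obtain ⟨C₂, hC₂⟩ := (hK.prod (isCompact_closedBall 0 1)).bddAbove_image hdrift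
  refine ⟨c, max 1 (max C₁ C₂), hc, by positivity, fun u hu ↦ ⟨hcb u hu, ?_, fun v hv ↦ ?_⟩⟩
  · exact (hC₁ ⟨u, hu, rfl⟩).trans (le_max_of_le_right (le_max_left _ _))
  · exact (hC₂ ⟨(u, v), ⟨hu, by simpa using hv⟩, rfl⟩).trans
      (le_max_of_le_right (le_max_right _ _))

/-- A solution of `-ΔF = μ F` without zeros on a Euclidean ball of radius `ρ ≤ 1` inside a fixed
compact set has `μ ≤ κ / ρ²`, with `κ` independent of the ball. -/
theorem exists_forall_eigenvalue_mul_sq_le {U K : Set (EuclideanSpace ℝ (Fin m))}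
    (hK : IsCompact K) (hKU : K ⊆ U)
    (hg : ∀ u ∈ U, ∀ i j, ContDiffAt ℝ 1 (fun w ↦ g w i j) u) (hpos : ∀ u ∈ U, (g u).PosDef) :
    ∃ κ : ℝ, 0 < κ ∧ ∀ (u₀ : EuclideanSpace ℝ (Fin m)) (ρ : ℝ), 0 < ρ → ρ ≤ 1 →
      closedBall u₀ ρ ⊆ K → ∀ (F : EuclideanSpace ℝ (Fin m) → ℝ) (μ : ℝ),
      (∀ u ∈ closedBall u₀ ρ, ContDiffAt ℝ 2 F u) → (∀ u ∈ closedBall u₀ ρ, F u ≠ 0) →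
      (∀ u ∈ closedBall u₀ ρ, -coordLaplacian g F u = μ * F u) → μ * ρ ^ 2 ≤ κ := by
  obtain ⟨c, C, hc, hC, hb⟩ := exists_ellipticity_bounds hK hKU hg hpos
  refine ⟨2 * (c + C) ^ 2 / c, by positivity, fun u₀ ρ hρ hρ1 hball F μ hF hF0 heig ↦ ?_⟩
  set ψ : EuclideanSpace ℝ (Fin m) → ℝ := fun w ↦ (ρ ^ 2 - ‖w - u₀‖ ^ 2) ^ 2 with hψ
  have hψc : Continuous ψ := by fun_prop
  have hu₀ : u₀ ∈ closedBall u₀ ρ := mem_closedBall_self hρ.le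
  obtain ⟨p, hp, hpmax⟩ := (isCompact_closedBall u₀ ρ).exists_isMaxOn ⟨u₀, hu₀⟩
    (f := fun w ↦ ψ w / |F w|) (fun w hw ↦ (hψc.continuousAt.div (hF w hw).continuousAt.abs
      (abs_pos.2 (hF0 w hw)).ne').continuousWithinAt)
  have hpos₀ : 0 < ψ u₀ / |F u₀| := div_pos (by simp [hψ]; positivity) (abs_pos.2 (hF0 u₀ hu₀))
  have hψp : 0 < ψ p := by
    by_contra! h
    exact absurd (hpos₀.trans_le (hpmax hu₀)) (not_lt.2 (div_nonpos_of_nonpos_of_nonneg h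
      (abs_nonneg _)))
  -- The barrier vanishes on the sphere, so the maximum is reached inside the ball.
  have hpρ : ‖p - u₀‖ < ρ := by
    refine lt_of_le_of_ne (by simpa [dist_eq_norm] using hp) fun h ↦ ?_
    simp [hψ, h] at hψp
  have hlocal : IsLocalMax (fun w ↦ ψ w / |F w|) p :=
    hpmax.isLocalMax (mem_of_superset (isOpen_ball.mem_nhds
      (by simpa [dist_eq_norm] using hpρ)) ball_subset_closedBall)
  obtain ⟨hell, htr, hdr⟩ := hb p (hball hp)
  have hpU := hKU (hball hp)
  have hψ2 : ContDiffAt ℝ 2 ψ p :=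
    (contDiffAt_const.sub ((contDiffAt_id.sub contDiffAt_const).norm_sq ℝ)).pow 2
  have h1 := coordLaplacian_le_of_isLocalMax_div_abs (hg p hpU) (hpos p hpU) (hF p hp) hψ2
    (hF0 p hp) hlocal (heig p hp)
  have h2 := neg_mul_barrier_le_coordLaplacian (hg p hpU) (hpos p hpU) hc hell htr hdr hρ1 hpρ
  have h3 := mul_le_mul_of_nonneg_left h1 (sq_nonneg ρ)
  refine le_of_mul_le_mul_right (a := ψ p) ?_ hψp
  change -(2 * (c + C) ^ 2 / c * ψ p) ≤ ρ ^ 2 * coordLaplacian g ψ p at h2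
  linarith

end Barrier

/-! ### The metric in a chart -/

section Charts

variable {m : ℕ} {M : Type*} [TopologicalSpace M] [ChartedSpace (EuclideanSpace ℝ (Fin m)) M]

theorem sum_smul_coordVector (e : OpenPartialHomeomorph M (EuclideanSpace ℝ (Fin m)))
    (u : EuclideanSpace ℝ (Fin m)) (v : Fin m → ℝ) :
    ∑ i, v i • coordVector e i u =
      mfderiv (𝓡 m) (𝓡 m) e.symm u (WithLp.toLp 2 v : EuclideanSpace ℝ (Fin m)) := by
  have : (WithLp.toLp 2 v : EuclideanSpace ℝ (Fin m)) =
      ∑ i, v i • EuclideanSpace.single i (1 : ℝ) := by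
    ext j
    simp [Finset.sum_apply, Pi.single_apply]
  rw [this]
  erw [map_sum]
  exact Finset.sum_congr rfl fun i _ ↦ ((mfderiv (𝓡 m) (𝓡 m) e.symm u).map_smul _ _).symm

variable [IsManifold (𝓡 m) ∞ M]

theorem contMDiffOn_symm_of_mem_atlas {e : OpenPartialHomeomorph M (EuclideanSpace ℝ (Fin m))}
    (he : e ∈ atlas (EuclideanSpace ℝ (Fin m)) M) :
    ContMDiffOn (𝓡 m) (𝓡 m) ∞ e.symm e.target :=
  contMDiffOn_symm_of_mem_maximalAtlas (IsManifold.subset_maximalAtlas (I := 𝓡 m) he)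

theorem contMDiffAt_coordVector {e : OpenPartialHomeomorph M (EuclideanSpace ℝ (Fin m))}
    (he : e ∈ atlas (EuclideanSpace ℝ (Fin m)) M) {u : EuclideanSpace ℝ (Fin m)}
    (hu : u ∈ e.target) (i : Fin m) :
    ContMDiffAt (𝓡 m) (𝓡 m).tangent 1
      (fun w ↦ (⟨e.symm w, coordVector e i w⟩ : TangentBundle (𝓡 m) M)) u := by
  have h1 : ContMDiffOn (𝓡 m) (𝓡 m) 2 e.symm e.target :=
    (contMDiffOn_symm_of_mem_atlas he).of_le (by norm_cast)
  have h2 := h1.contMDiffOn_tangentMapWithin (m := 1) (by norm_num) e.open_target.uniqueMDiffOn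
  have h3 : ContMDiff (𝓡 m) (𝓡 m).tangent 1 (fun w : EuclideanSpace ℝ (Fin m) ↦
      (⟨w, EuclideanSpace.single i (1 : ℝ)⟩ : TangentBundle (𝓡 m) (EuclideanSpace ℝ (Fin m)))) :=
    fun w ↦ contMDiffAt_vectorSpace_iff_contDiffAt.2 contDiffAt_const
  have h4 := h2.comp h3.contMDiffOn (s := e.target) fun w hw ↦ hw
  refine (h4.contMDiffAt (e.open_target.mem_nhds hu)).congr_of_eventuallyEq ?_
  filter_upwards [e.open_target.mem_nhds hu] with w hw
  simp only [Function.comp, tangentMapWithin, coordVector]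
  rw [mfderivWithin_of_mem_nhds (e.open_target.mem_nhds hw)]

variable [RiemannianBundle (fun x : M ↦ TangentSpace (𝓡 m) x)]

theorem contDiffAt_metricMatrix [IsContMDiffRiemannianBundle (𝓡 m) ∞ (EuclideanSpace ℝ (Fin m))
      (fun x : M ↦ TangentSpace (𝓡 m) x)]
    {e : OpenPartialHomeomorph M (EuclideanSpace ℝ (Fin m))}
    (he : e ∈ atlas (EuclideanSpace ℝ (Fin m)) M) {u : EuclideanSpace ℝ (Fin m)}
    (hu : u ∈ e.target) (i j : Fin m) : ContDiffAt ℝ 1 (fun w ↦ metricMatrix e w i j) u := by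
  have : IsContMDiffRiemannianBundle (𝓡 m) 1 (EuclideanSpace ℝ (Fin m))
      (fun x : M ↦ TangentSpace (𝓡 m) x) :=
    IsContMDiffRiemannianBundle.of_le (n := ∞) (by norm_cast)
  exact contMDiffAt_iff_contDiffAt.1
    ((contMDiffAt_coordVector he hu i).inner_bundle (contMDiffAt_coordVector he hu j))

theorem posDef_metricMatrix {e : OpenPartialHomeomorph M (EuclideanSpace ℝ (Fin m))}
    (he : e ∈ atlas (EuclideanSpace ℝ (Fin m)) M) {u : EuclideanSpace ℝ (Fin m)}
    (hu : u ∈ e.target) : (metricMatrix e u).PosDef := by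
  refine Matrix.PosDef.of_dotProduct_mulVec_pos ?_ fun v hv ↦ ?_
  · ext i j
    simp [metricMatrix, real_inner_comm]
  have hdiff : e.MDifferentiable (𝓡 m) (𝓡 m) := mdifferentiable_of_mem_atlas he
  have hne : ∑ i, v i • coordVector e i u ≠ 0 := by
    rw [sum_smul_coordVector]
    intro h
    have h2 := congr($(hdiff.comp_symm_deriv hu) (WithLp.toLp 2 v : EuclideanSpace ℝ (Fin m)))
    have h3 : (mfderiv (𝓡 m) (𝓡 m) e (e.symm u)) (mfderiv (𝓡 m) (𝓡 m) e.symm u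
        (WithLp.toLp 2 v : EuclideanSpace ℝ (Fin m))) = WithLp.toLp 2 v := h2
    rw [h, map_zero] at h3
    exact hv (congrArg WithLp.ofLp h3).symm
  have := real_inner_self_pos.2 hne
  simp only [sum_inner, inner_sum, real_inner_smul_left, real_inner_smul_right] at this
  simp only [dotProduct, Matrix.mulVec, metricMatrix, Matrix.of_apply, Finset.mul_sum,
    Pi.star_apply, star_trivial]
  refine this.trans_eq (Finset.sum_congr rfl fun i _ ↦ Finset.sum_congr rfl fun j _ ↦ ?_)
  rw [real_inner_comm]
  ring

end Charts

/-! ### Comparison of the Riemannian and the coordinate distance -/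

section ChartLipschitz

variable {m : ℕ} {M : Type*} [TopologicalSpace M] [ChartedSpace (EuclideanSpace ℝ (Fin m)) M]
  [IsManifold (𝓡 m) ∞ M] [RiemannianBundle (fun x : M ↦ TangentSpace (𝓡 m) x)]
  [IsContMDiffRiemannianBundle (𝓡 m) ∞ (EuclideanSpace ℝ (Fin m))
    (fun x : M ↦ TangentSpace (𝓡 m) x)]
  {e : OpenPartialHomeomorph M (EuclideanSpace ℝ (Fin m))}
  {K : Set (EuclideanSpace ℝ (Fin m))}

theorem exists_norm_sum_smul_coordVector_le (he : e ∈ atlas (EuclideanSpace ℝ (Fin m)) M)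
    (hK : IsCompact K) (hKe : K ⊆ e.target) :
    ∃ C : ℝ≥0, 0 < C ∧ ∀ w ∈ K, ∀ v : EuclideanSpace ℝ (Fin m),
      ‖∑ i, v i • coordVector e i w‖ₑ ≤ C * ‖v‖ₑ := by
  have hcont : ContinuousOn (fun w ↦ ∑ i, √(metricMatrix e w i i)) K :=
    continuousOn_finsetSum _ fun i _ w hw ↦
      (contDiffAt_metricMatrix he (hKe hw) i i).continuousAt.sqrt.continuousWithinAt
  obtain ⟨C, hC⟩ := hK.bddAbove_image hcont
  refine ⟨(max C 1).toNNReal, by simp, fun w hw v ↦ ?_⟩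
  have hcv (i : Fin m) : ‖coordVector e i w‖ = √(metricMatrix e w i i) := by
    simp only [metricMatrix, Matrix.of_apply]
    exact norm_eq_sqrt_real_inner _
  have h : ‖∑ i, v i • coordVector e i w‖ ≤ max C 1 * ‖v‖ :=
    calc ‖∑ i, v i • coordVector e i w‖ ≤ ∑ i, ‖v‖ * √(metricMatrix e w i i) := by
          refine norm_sum_le_of_le _ fun i _ ↦ ?_
          rw [norm_smul, hcv]
          exact mul_le_mul_of_nonneg_right (PiLp.norm_apply_le v i) (Real.sqrt_nonneg _)
      _ = (∑ i, √(metricMatrix e w i i)) * ‖v‖ := by rw [← Finset.mul_sum, mul_comm]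
      _ ≤ max C 1 * ‖v‖ := by
          gcongr
          exact (hC ⟨w, hw, rfl⟩).trans (le_max_left _ _)
  rw [← ofReal_norm, ← ofReal_norm]
  change _ ≤ ENNReal.ofReal (max C 1) * _
  rw [← ENNReal.ofReal_mul (by positivity)]
  exact ENNReal.ofReal_le_ofReal h

/-- The inverse of a chart is Lipschitz for the Riemannian distance on compact convex sets: segments
in the chart lift to paths of comparable length. -/
theorem exists_riemannianEDist_symm_le (he : e ∈ atlas (EuclideanSpace ℝ (Fin m)) M)
    (hK : IsCompact K) (hKe : K ⊆ e.target) (hconv : Convex ℝ K) :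
    ∃ C : ℝ≥0, 0 < C ∧ ∀ u ∈ K, ∀ v ∈ K,
      riemannianEDist (𝓡 m) (e.symm u) (e.symm v) ≤ C * edist u v := by
  obtain ⟨C, C_pos, hC⟩ := exists_norm_sum_smul_coordVector_le he hK hKe
  refine ⟨C, C_pos, fun u hu v hv ↦ ?_⟩
  let η := ContinuousAffineMap.lineMap (R := ℝ) u v
  set γ := e.symm ∘ η
  have hη : Set.Icc 0 1 ⊆ ⇑η ⁻¹' K := by
    simp only [← Set.image_subset_iff, ContinuousAffineMap.coe_lineMap_eq,
     ← segment_eq_image_lineMap, η]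
    exact hconv.segment_subset hu hv
  have hsymm : ContMDiffOn (𝓡 m) (𝓡 m) 1 e.symm e.target :=
    (contMDiffOn_symm_of_mem_atlas he).of_le (by norm_cast)
  have η_smooth : ContMDiff 𝓘(ℝ, ℝ) (𝓡 m) 1 η := by
    rw [contMDiff_iff_contDiff]
    exact ContinuousAffineMap.contDiff _
  have hη' (t : ℝ) : mfderiv 𝓘(ℝ, ℝ) (𝓡 m) η t (1 : ℝ) = v - u := by
    have h : HasDerivAt η (v - u) t := AffineMap.hasDerivAt_lineMap
    rw [mfderiv_eq_fderiv, h.hasFDerivAt.fderiv]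
    exact one_smul ℝ (v - u)
  have : riemannianEDist (𝓡 m) (e.symm u) (e.symm v) ≤ pathELength (𝓡 m) γ 0 1 := by
    apply riemannianEDist_le_pathELength _ _ _ zero_le_one
    · exact hsymm.comp η_smooth.contMDiffOn (hη.trans (Set.preimage_mono hKe))
    · simp [γ, η, ContinuousAffineMap.coe_lineMap_eq]
    · simp [γ, η, ContinuousAffineMap.coe_lineMap_eq]
  apply this.trans
  rw [pathELength_eq_lintegral_mfderiv_Icc]
  calc ∫⁻ t in Set.Icc 0 1, ‖mfderiv 𝓘(ℝ, ℝ) (𝓡 m) γ t 1‖ₑ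
      ≤ ∫⁻ _ in Set.Icc (0 : ℝ) 1, C * edist u v := by
        refine MeasureTheory.setLIntegral_mono' measurableSet_Icc fun t ht ↦ ?_
        have h1 : mfderiv 𝓘(ℝ, ℝ) (𝓡 m) γ t =
            (mfderiv (𝓡 m) (𝓡 m) e.symm (η t)) ∘L (mfderiv 𝓘(ℝ, ℝ) (𝓡 m) η t) :=
          mfderiv_comp _ ((hsymm.contMDiffAt
            (e.open_target.mem_nhds (hKe (hη ht)))).mdifferentiableAt one_ne_zero)
            (η_smooth.mdifferentiable one_ne_zero t)
        have h2 : mfderiv 𝓘(ℝ, ℝ) (𝓡 m) γ t (1 : ℝ) =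
            ∑ i, (v - u) i • coordVector e i (η t) := by
          rw [sum_smul_coordVector, h1]
          exact congrArg (mfderiv (𝓡 m) (𝓡 m) e.symm (η t)) (hη' t)
        have h3 := hC (η t) (hη ht) (v - u)
        rw [← h2, ← edist_eq_enorm_sub, edist_comm] at h3
        exact h3
    _ = C * edist u v := by simp

end ChartLipschitz

/-! ### Zero-free balls of eigenfunctions -/

section Eigenfunctions

variable {m : ℕ} {M : Type*} [TopologicalSpace M] [ChartedSpace (EuclideanSpace ℝ (Fin m)) M]
  [RiemannianBundle (fun x : M ↦ TangentSpace (𝓡 m) x)]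
  {e : OpenPartialHomeomorph M (EuclideanSpace ℝ (Fin m))} {lam : ℝ} {φ : M → ℝ}

theorem IsLaplaceEigenfunction.contDiffAt_comp_symm [IsManifold (𝓡 m) ∞ M]
    (hφ : IsLaplaceEigenfunction (m := m) lam φ)
    (he : e ∈ atlas (EuclideanSpace ℝ (Fin m)) M) {u : EuclideanSpace ℝ (Fin m)}
    (hu : u ∈ e.target) : ContDiffAt ℝ 2 (fun w ↦ φ (e.symm w)) u := by
  have h1 : ContMDiffOn (𝓡 m) (𝓡 m) 2 e.symm e.target :=
    (contMDiffOn_symm_of_mem_atlas he).of_le (by norm_cast)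
  exact contMDiffAt_iff_contDiffAt.1
    (hφ.contMDiff.contMDiffAt.comp u (h1.contMDiffAt (e.open_target.mem_nhds hu)))

theorem IsLaplaceEigenfunction.coordLaplacian_comp_symm
    (hφ : IsLaplaceEigenfunction (m := m) lam φ)
    (he : e ∈ atlas (EuclideanSpace ℝ (Fin m)) M) {u : EuclideanSpace ℝ (Fin m)}
    (hu : u ∈ e.target) :
    -coordLaplacian (metricMatrix e) (fun w ↦ φ (e.symm w)) u = lam ^ 2 * φ (e.symm u) := by
  have := hφ.eigen e he (e.symm u) (e.map_target hu)
  rwa [e.right_inv hu] at this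

variable [IsManifold (𝓡 m) ∞ M]
  [IsContMDiffRiemannianBundle (𝓡 m) ∞ (EuclideanSpace ℝ (Fin m))
    (fun x : M ↦ TangentSpace (𝓡 m) x)]

/-- The absolute value of an eigenfunction has no positive local minimum. -/
theorem IsLaplaceEigenfunction.eq_zero_of_isLocalMin_abs
    (hφ : IsLaplaceEigenfunction (m := m) lam φ) (hlam : 0 < lam) {p : M}
    (hmin : IsLocalMin (fun y ↦ |φ y|) p) : φ p = 0 := by
  by_contra hp
  set e := chartAt (EuclideanSpace ℝ (Fin m)) p with he_def
  have he : e ∈ atlas (EuclideanSpace ℝ (Fin m)) M := chart_mem_atlas _ p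
  have hpe : p ∈ e.source := mem_chart_source _ p
  have hu : e p ∈ e.target := e.map_source hpe
  have hsymm : e.symm (e p) = p := e.left_inv hpe
  have hF := hφ.contDiffAt_comp_symm he hu
  have htend : Tendsto e.symm (𝓝 (e p)) (𝓝 p) := by
    simpa [hsymm] using (e.continuousAt_symm hu).tendsto
  have hmax : IsLocalMax (fun w ↦ 1 / |φ (e.symm w)|) (e p) := by
    filter_upwards [htend.eventually hmin] with w hw
    rw [hsymm]
    exact one_div_le_one_div_of_le (abs_pos.2 hp) hw
  have h := coordLaplacian_le_of_isLocalMax_div_abs (ψ := fun _ ↦ 1)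
    (contDiffAt_metricMatrix he hu) (posDef_metricMatrix he hu) hF contDiffAt_const
    (by rwa [hsymm]) hmax (hφ.coordLaplacian_comp_symm he hu)
  have h0 : coordLaplacian (metricMatrix e) (fun _ ↦ 1) (e p) = 0 := by
    simp [coordLaplacian, coordDeriv]
  rw [h0] at h
  nlinarith

end Eigenfunctions

section ZeroFreeBalls

variable {m : ℕ} {M : Type*} [EMetricSpace M] [ChartedSpace (EuclideanSpace ℝ (Fin m)) M]
  [RiemannianBundle (fun x : M ↦ TangentSpace (𝓡 m) x)]

variable (m) in
/-- The eigenvalue bound `lam² ≤ κ / ρ²` holds for all eigenfunctions without zeros on a ball with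
centre in `s` and radius greater than `L * ρ`, at all scales `ρ ≤ ε`. -/
def HasZeroFreeBallBound (s : Set M) (ε L κ : ℝ) : Prop :=
  ∀ x ∈ s, ∀ (lam : ℝ) (φ : M → ℝ), IsLaplaceEigenfunction (m := m) lam φ →
    ∀ ρ r : ℝ, 0 < ρ → ρ ≤ ε → L * ρ < r → (∀ y ∈ eball x (ENNReal.ofReal r), φ y ≠ 0) →
      lam ^ 2 * ρ ^ 2 ≤ κ

theorem HasZeroFreeBallBound.mono {s t : Set M} {ε ε' L L' κ κ' : ℝ}
    (h : HasZeroFreeBallBound m t ε L κ) (hst : s ⊆ t) (hε : ε' ≤ ε) (hL : L ≤ L') (hκ : κ ≤ κ') :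
    HasZeroFreeBallBound m s ε' L' κ' :=
  fun x hx lam φ hφ ρ r hρ hρε hr hne ↦ (h x (hst hx) lam φ hφ ρ r hρ (hρε.trans hε)
    ((mul_le_mul_of_nonneg_right hL hρ.le).trans_lt hr) hne).trans hκ

theorem HasZeroFreeBallBound.union {s t : Set M} {ε L κ : ℝ} (hs : HasZeroFreeBallBound m s ε L κ)
    (ht : HasZeroFreeBallBound m t ε L κ) : HasZeroFreeBallBound m (s ∪ t) ε L κ :=
  fun x hx ↦ hx.elim (hs x) (ht x)

variable [IsManifold (𝓡 m) ∞ M]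
  [IsContMDiffRiemannianBundle (𝓡 m) ∞ (EuclideanSpace ℝ (Fin m))
    (fun x : M ↦ TangentSpace (𝓡 m) x)]
  [IsRiemannianManifold (𝓡 m) M]

theorem exists_nhds_hasZeroFreeBallBound (p : M) :
    ∃ V ∈ 𝓝 p, ∃ ε L κ : ℝ, 0 < ε ∧ 0 < L ∧ 0 < κ ∧ HasZeroFreeBallBound m V ε L κ := by
  set e := chartAt (EuclideanSpace ℝ (Fin m)) p with he_def
  have he : e ∈ atlas (EuclideanSpace ℝ (Fin m)) M := chart_mem_atlas _ p
  have hpe : p ∈ e.source := mem_chart_source _ p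
  obtain ⟨R, hR, hRe⟩ := nhds_basis_closedBall.mem_iff.1
    (e.open_target.mem_nhds (e.map_source hpe))
  have hK := isCompact_closedBall (e p) R
  obtain ⟨L, hL, hLip⟩ := exists_riemannianEDist_symm_le he hK hRe (convex_closedBall _ _)
  obtain ⟨κ, hκ, hbound⟩ := exists_forall_eigenvalue_mul_sq_le hK hRe
    (fun u hu ↦ contDiffAt_metricMatrix he hu) (fun u hu ↦ posDef_metricMatrix he hu)
  refine ⟨e.source ∩ e ⁻¹' ball (e p) (R / 2), inter_mem (e.open_source.mem_nhds hpe)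
    ((e.continuousAt hpe).preimage_mem_nhds (ball_mem_nhds _ (by positivity))),
    min 1 (R / 2), L, κ, by positivity, by exact_mod_cast hL, hκ, ?_⟩
  rintro x ⟨hxe, hx⟩ lam φ hφ ρ r hρ hρε hr hne
  have hx' : dist (e x) (e p) < R / 2 := hx
  have hsub : closedBall (e x) ρ ⊆ closedBall (e p) R :=
    closedBall_subset_closedBall' (by linarith [hρε.trans (min_le_right _ _)])
  have hin : ∀ u ∈ closedBall (e x) ρ, e.symm u ∈ eball x (ENNReal.ofReal r) := by
    intro u hu
    have h1 := hLip u (hsub hu) (e x) (hsub (mem_closedBall_self hρ.le))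
    rw [e.left_inv hxe, ← IsRiemannianManifold.out] at h1
    refine mem_eball.2 (h1.trans_lt ?_)
    calc (L : ℝ≥0∞) * edist u (e x) ≤ L * ENNReal.ofReal ρ := by
          gcongr
          rw [edist_dist]
          exact ENNReal.ofReal_le_ofReal hu
      _ = ENNReal.ofReal (L * ρ) := by
          rw [ENNReal.ofReal_mul L.coe_nonneg, ENNReal.ofReal_coe_nnreal]
      _ < ENNReal.ofReal r :=
          (ENNReal.ofReal_lt_ofReal_iff (lt_of_le_of_lt (by positivity) hr)).2 hr
  exact hbound (e x) ρ hρ (hρε.trans (min_le_left _ _)) hsub (fun w ↦ φ (e.symm w)) (lam ^ 2)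
    (fun u hu ↦ hφ.contDiffAt_comp_symm he (hRe (hsub hu)))
    (fun u hu ↦ hne _ (hin u hu))
    (fun u hu ↦ hφ.coordLaplacian_comp_symm he (hRe (hsub hu)))

variable (m M) in
theorem exists_hasZeroFreeBallBound_univ [CompactSpace M] :
    ∃ ε L κ : ℝ, 0 < ε ∧ 0 < L ∧ 0 < κ ∧ HasZeroFreeBallBound m (Set.univ : Set M) ε L κ := by
  refine isCompact_univ.induction_on (p := fun s : Set M ↦ ∃ ε L κ : ℝ, 0 < ε ∧ 0 < L ∧ 0 < κ ∧
    HasZeroFreeBallBound m s ε L κ) ?_ ?_ ?_ ?_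
  · exact ⟨1, 1, 1, one_pos, one_pos, one_pos, fun x hx ↦ hx.elim⟩
  · rintro s t hst ⟨ε, L, κ, hε, hL, hκ, h⟩
    exact ⟨ε, L, κ, hε, hL, hκ, h.mono hst le_rfl le_rfl le_rfl⟩
  · rintro s t ⟨ε, L, κ, hε, hL, hκ, h⟩ ⟨ε', L', κ', hε', hL', hκ', h'⟩
    exact ⟨min ε ε', max L L', max κ κ', lt_min hε hε', lt_max_of_lt_left hL,
      lt_max_of_lt_left hκ,
      (h.mono subset_rfl (min_le_left _ _) (le_max_left _ _) (le_max_left _ _)).union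
        (h'.mono subset_rfl (min_le_right _ _) (le_max_right _ _) (le_max_right _ _))⟩
  · intro p _
    obtain ⟨V, hV, h⟩ := exists_nhds_hasZeroFreeBallBound (m := m) p
    exact ⟨V, mem_nhdsWithin_of_mem_nhds hV, h⟩

end ZeroFreeBalls

/-- In a compact extended metric space the finite distances are bounded. -/
theorem exists_edist_le_of_edist_lt_top (X : Type*) [PseudoEMetricSpace X] [CompactSpace X] :
    ∃ D : ℝ, 0 ≤ D ∧ ∀ x y : X, edist x y < ⊤ → edist x y ≤ ENNReal.ofReal D := by
  have hclosed : IsClosed {q : X × X | edist q.1 q.2 < ⊤} := by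
    refine isOpen_compl_iff.1 (isOpen_iff_mem_nhds.2 fun q hq ↦ ?_)
    have h1 : ∀ᶠ z : X × X in 𝓝 q, edist z.1 q.1 < 1 :=
      continuous_fst.continuousAt.eventually (eball_mem_nhds q.1 one_pos)
    have h2 : ∀ᶠ z : X × X in 𝓝 q, edist z.2 q.2 < 1 :=
      continuous_snd.continuousAt.eventually (eball_mem_nhds q.2 one_pos)
    filter_upwards [h1, h2] with z hz1 hz2 hz
    refine hq ?_
    calc edist q.1 q.2 ≤ edist q.1 z.1 + edist z.1 z.2 + edist z.2 q.2 := edist_triangle4 _ _ _ _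
      _ < ⊤ := ENNReal.add_lt_top.2 ⟨ENNReal.add_lt_top.2
          ⟨(edist_comm q.1 z.1 ▸ hz1).trans ENNReal.one_lt_top, hz⟩,
          hz2.trans ENNReal.one_lt_top⟩
  rcases Set.eq_empty_or_nonempty {q : X × X | edist q.1 q.2 < ⊤} with h | h
  · exact ⟨0, le_rfl, fun x y hxy ↦ ((Set.ext_iff.1 h (x, y)).1 hxy).elim⟩
  · obtain ⟨q, hq, hmax⟩ := hclosed.isCompact.exists_isMaxOn h continuous_edist.continuousOn
    refine ⟨(edist q.1 q.2).toReal, ENNReal.toReal_nonneg, fun x y hxy ↦ ?_⟩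
    rw [ENNReal.ofReal_toReal (ne_of_lt hq)]
    exact hmax (a := (x, y)) hxy

theorem proposition2p1 {m : ℕ} {M : Type*} [EMetricSpace M] [CompactSpace M]
    [ChartedSpace (EuclideanSpace ℝ (Fin m)) M] [IsManifold (𝓡 m) ∞ M]
    [RiemannianBundle (fun x : M ↦ TangentSpace (𝓡 m) x)]
    [IsContMDiffRiemannianBundle (𝓡 m) ∞ (EuclideanSpace ℝ (Fin m))
      (fun x : M ↦ TangentSpace (𝓡 m) x)]
    [IsRiemannianManifold (𝓡 m) M] :
    ∃ A : ℝ, 0 < A ∧ ∀ (lam : ℝ) (φ : M → ℝ), 0 < lam →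
      IsLaplaceEigenfunction (m := m) lam φ →
      ∀ (x : M) (r : ℝ), A / lam < r → ∃ y ∈ Metric.eball x (ENNReal.ofReal r), φ y = 0 := by
  obtain ⟨ε, L, κ, hε, hL, hκ, hbound⟩ := exists_hasZeroFreeBallBound_univ m M
  obtain ⟨D, hD, hDM⟩ := exists_edist_le_of_edist_lt_top M
  -- `2 L √κ` rules out small radii, `D √κ / ε` makes large balls contain the component of the
  -- centre.
  refine ⟨2 * L * √κ + D * √κ / ε + 1, by positivity, fun lam φ hlam hφ x r hr ↦ ?_⟩
  rw [div_lt_iff₀ hlam] at hr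
  have hr0 : 0 < r := by
    by_contra! h
    have : 0 ≤ 2 * L * √κ + D * √κ / ε := by positivity
    nlinarith
  by_contra! hne
  have hroot : ∀ ρ : ℝ, 0 < ρ → ρ ≤ ε → L * ρ < r → lam * ρ ≤ √κ := fun ρ h1 h2 h3 ↦
    Real.le_sqrt_of_sq_le (by
      rw [mul_pow]; exact hbound x (Set.mem_univ x) lam φ hφ ρ r h1 h2 h3 hne)
  have hterm1 : 0 ≤ 2 * L * √κ := by positivity
  have hterm2 : 0 ≤ D * √κ / ε := by positivity
  rcases le_total (r / (2 * L)) ε with hrε | hrε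
  · have h := hroot (r / (2 * L)) (by positivity) hrε (by
      rw [mul_div_assoc', div_lt_iff₀ (by positivity)]; nlinarith)
    rw [mul_div_assoc', div_le_iff₀ (by positivity)] at h
    linarith
  · rw [le_div_iff₀ (by positivity)] at hrε
    have h := hroot ε hε le_rfl (by nlinarith)
    have hDr : D < r := by
      have h1 : D * lam ≤ D * √κ / ε := by
        rw [le_div_iff₀ hε, mul_assoc]
        exact mul_le_mul_of_nonneg_left h hD
      exact lt_of_mul_lt_mul_right (by linarith : D * lam < r * lam) hlam.le
    have hclopen : IsClopen (eball x ⊤) := ⟨isClosed_eball_top, isOpen_eball⟩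
    have hcomp : ∀ y ∈ eball x ⊤, φ y ≠ 0 := fun y hy ↦ hne y (mem_eball.2
      ((hDM y x hy).trans_lt ((ENNReal.ofReal_lt_ofReal_iff hr0).2 hDr)))
    obtain ⟨p, hp, hmin⟩ := hclopen.isClosed.isCompact.exists_isMinOn
      ⟨x, mem_eball_self (by simp)⟩ hφ.contMDiff.continuous.abs.continuousOn
    exact hcomp p hp (hφ.eq_zero_of_isLocalMin_abs hlam
      (hmin.isLocalMin (hclopen.isOpen.mem_nhds hp)))
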